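/- Let $R$ be an associative ring with identity and let $M$ be a unital $R$-module with injective hull $E(M)\supseteq M$. Call $M$ automorphism-invariant if $g(M)\subseteq M$ for every automorphism $g$ of $E(M)$. If $M$ is automorphism-invariant, then its endomorphism ring $\operatorname{End}_R(M)$ is a clean ring; that is, every $a\in\operatorname{End}_R(M)$ can be written as $a=e+u$ with $e\in\operatorname{End}_R(M)$ idempotent and $u\in\operatorname{End}_R(M)$ a unit. -/

import Mathlib

universe u v w

/-- A submodule `N` of `E` is essential if it meets every nonzero submodule of `E`
nontrivially. -/
def IsEssentialSubmodule {R : Type u} [Ring R] {E : Type w} [AddCommGroup E] [Module R E]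
    (N : Submodule R E) : Prop :=
  ∀ L : Submodule R E, N ⊓ L = ⊥ → L = ⊥

/-- `i : M → E` is an injective hull of `M`: `E` is an injective module, `i` is a monomorphism,
and the image of `i` is essential in `E`. The module `E` lives in a universe containing `R`, so
that `Module.Injective` is the usual injectivity, with no restriction on the size of the test
modules. -/
structure IsInjectiveHull {R : Type u} [Ring R] {M : Type v} [AddCommGroup M] [Module R M]
    {E : Type (max u v)} [AddCommGroup E] [Module R E] (i : M →ₗ[R] E) : Prop where
  injective_module : Module.Injective R E
  injective_map : Function.Injective i
  essential_range : IsEssentialSubmodule (LinearMap.range i)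

/-- `M` is automorphism-invariant: viewing `M` inside its injective hull `E`, one has `g(M) ⊆ M`
for every automorphism `g` of `E`. (Every module has an injective hull in the universe
`max u v`, and any two are isomorphic over `M`, so the choice of the hull is immaterial; see
`isAutomorphismInvariant_iff`.) -/
def IsAutomorphismInvariant (R : Type u) [Ring R] (M : Type v) [AddCommGroup M] [Module R M] :
    Prop :=
  ∃ (E : Type (max u v)) (_ : AddCommGroup E) (_ : Module R E) (i : M →ₗ[R] E),
    IsInjectiveHull i ∧
      ∀ g : E ≃ₗ[R] E, (LinearMap.range i).map (g : E →ₗ[R] E) ≤ LinearMap.range i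

/-- Two injective hulls of `M` are isomorphic over `M`. -/
theorem IsInjectiveHull.exists_equiv {R : Type u} [Ring R] {M : Type v} [AddCommGroup M]
    [Module R M] {E F : Type (max u v)} [AddCommGroup E] [Module R E] [AddCommGroup F]
    [Module R F] {i : M →ₗ[R] E} {j : M →ₗ[R] F} (hi : IsInjectiveHull i)
    (hj : IsInjectiveHull j) : ∃ f : E ≃ₗ[R] F, ∀ m, f (i m) = j m := by
  have key : ∀ {A B : Type (max u v)} [AddCommGroup A] [Module R A] [AddCommGroup B]
      [Module R B] {a : M →ₗ[R] A} {b : M →ₗ[R] B}, IsInjectiveHull a → IsInjectiveHull b →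
      ∃ f : A →ₗ[R] B, Function.Injective f ∧ ∀ m, f (a m) = b m := by
    intro A B _ _ _ _ a b ha hb
    let e := LinearEquiv.ofInjective a ha.injective_map
    obtain ⟨f, hf⟩ := hb.injective_module.out (LinearMap.range a).subtype
      Subtype.val_injective (b ∘ₗ e.symm.toLinearMap)
    have hfa : ∀ m, f (a m) = b m := fun m => by
      simpa [e] using hf (e m)
    refine ⟨f, LinearMap.ker_eq_bot.1 (ha.essential_range _ ?_), hfa⟩
    rw [eq_bot_iff]
    rintro _ ⟨⟨m, rfl⟩, hm⟩
    have h0 : b m = 0 := by rw [← hfa]; exact hm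
    rw [hb.injective_map (h0.trans (map_zero b).symm)]
    simp
  obtain ⟨f, hf, hfi⟩ := key hi hj
  -- a retraction of `f`, whose kernel meets `j(M)` trivially
  obtain ⟨r, hr⟩ := hi.injective_module.out f hf LinearMap.id
  have hker : LinearMap.ker r = ⊥ := by
    refine hj.essential_range _ ?_
    rw [eq_bot_iff]
    rintro _ ⟨⟨m, rfl⟩, hm⟩
    have h0 : i m = 0 := by
      have h1 : r (j m) = 0 := hm
      rw [← hfi, hr] at h1
      exact h1
    rw [hi.injective_map (h0.trans (map_zero i).symm)]
    simp
  have hsurj : Function.Surjective f := fun y =>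
    ⟨r y, LinearMap.ker_eq_bot.1 hker (hr (r y))⟩
  exact ⟨LinearEquiv.ofBijective f ⟨hf, hsurj⟩, hfi⟩

/-- Automorphism-invariance can be tested on any injective hull. -/
theorem isAutomorphismInvariant_iff {R : Type u} [Ring R] {M : Type v} [AddCommGroup M]
    [Module R M] {E : Type (max u v)} [AddCommGroup E] [Module R E] {i : M →ₗ[R] E}
    (hi : IsInjectiveHull i) :
    IsAutomorphismInvariant R M ↔
      ∀ g : E ≃ₗ[R] E, (LinearMap.range i).map (g : E →ₗ[R] E) ≤ LinearMap.range i := by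
  refine ⟨?_, fun h => ⟨E, _, _, i, hi, h⟩⟩
  rintro ⟨F, _, _, j, hj, h⟩ g
  obtain ⟨f, hf⟩ := hi.exists_equiv hj
  rintro _ ⟨_, ⟨m, rfl⟩, rfl⟩
  obtain ⟨n, hn⟩ := h (f.symm.trans (g.trans f)) ⟨j m, ⟨m, rfl⟩, rfl⟩
  refine ⟨n, f.injective ?_⟩
  have h1 : f.symm (j m) = i m := by rw [← hf, f.symm_apply_apply]
  rw [hf, hn]
  simp [h1]

/-- A ring is clean if each of its elements is the sum of an idempotent and a unit. -/
def IsCleanRing (A : Type w) [Ring A] : Prop :=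
  ∀ a : A, ∃ e x : A, IsIdempotentElem e ∧ IsUnit x ∧ a = e + x

/-! By injectivity of E(M), an endomorphism of M extends to some f of E(M). If f = e + x with e
idempotent and x a unit, then x and its inverse preserve M by hypothesis, hence so does e = f - x,
and the decomposition restricts to M. It remains to see that the endomorphism ring of an injective E
is clean.

Cleanness is built on pieces: A is a part of the future kernel of e and B of its future range, so
that f - e must be f on A and f - 1 on B. By Zorn there is a maximal such pair. If A + B were not
essential, a complement K of its essential closure would be a nonzero injective module; the
endomorphism of K induced by f has a nonzero pair (`Module.Injective.exists_isCleanPair`), which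
enlarges the given one (`IsCleanPair.extend`). So A + B is essential. Projecting along complementary
summands containing A and B gives e, and essentiality makes f - e bijective. -/

/-! ### Complements and essential closures in injective modules -/

section Complements

variable {R : Type u} [Ring R] {E : Type w} [AddCommGroup E] [Module R E]

/-- Every submodule disjoint from `B` is contained in a maximal one. -/
theorem Submodule.exists_maximal_disjoint {A B : Submodule R E} (h : A ⊓ B = ⊥) :
    ∃ C, A ≤ C ∧ Maximal (fun L : Submodule R E => L ⊓ B = ⊥) C := by
  refine zorn_le_nonempty₀ {L : Submodule R E | L ⊓ B = ⊥} ?_ A h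
  intro c hc hchain y hy
  refine ⟨sSup c, ?_, fun z hz => le_sSup hz⟩
  refine eq_bot_iff.2 ?_
  rintro x ⟨hx, hxB⟩
  obtain ⟨L, hL, hxL⟩ := (Submodule.mem_sSup_of_directed ⟨y, hy⟩ hchain.directedOn).1 hx
  exact (hc hL).le ⟨hxL, hxB⟩

/-- Disjoint submodules of an injective module can be enlarged to complementary ones. -/
theorem Module.Injective.exists_isCompl_of_disjoint (hE : Module.Injective R E)
    {A B : Submodule R E} (h : A ⊓ B = ⊥) : ∃ A' B', A ≤ A' ∧ B ≤ B' ∧ IsCompl A' B' := by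
  obtain ⟨A', hAA', hA'⟩ := Submodule.exists_maximal_disjoint h
  obtain ⟨B', hBB', hB'⟩ := Submodule.exists_maximal_disjoint
    (show B ⊓ A' = ⊥ by rw [inf_comm]; exact hA'.prop)
  have hd : A' ⊓ B' = ⊥ := by rw [inf_comm]; exact hB'.prop
  have hmax : ∀ L, A' ≤ L → L ⊓ B' = ⊥ → L ≤ A' := fun L hL h' =>
    hA'.2 (eq_bot_iff.2 ((inf_le_inf_left L hBB').trans h'.le)) hL
  let ψ : A' × B' →ₗ[R] E := LinearMap.coprod A'.subtype B'.subtype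
  have hψ : Function.Injective ψ := by
    rw [injective_iff_map_eq_zero]
    rintro ⟨a, b⟩ hab
    have hab : (a : E) + b = 0 := hab
    have ha : (a : E) ∈ A' ⊓ B' :=
      ⟨a.2, by rw [eq_neg_of_add_eq_zero_left hab]; exact B'.neg_mem b.2⟩
    have ha0 : (a : E) = 0 := by rw [hd] at ha; exact ha
    have hb0 : (b : E) = 0 := by rwa [ha0, zero_add] at hab
    exact Prod.ext (Subtype.ext ha0) (Subtype.ext hb0)
  -- `h` extends the projection of `A' ⊕ B'` onto `B'` to all of `E`; maximality of `A'` and `B'`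
  -- forces its kernel into `A'` and its range into `B'`.
  obtain ⟨h, hh⟩ := hE.out ψ hψ (B'.subtype ∘ₗ LinearMap.snd R A' B')
  have hA : ∀ a ∈ A', h a = 0 := fun a ha => by simpa [ψ] using hh (⟨a, ha⟩, 0)
  have hB : ∀ b ∈ B', h b = b := fun b hb => by simpa [ψ] using hh (0, ⟨b, hb⟩)
  -- a preimage under `h` of a submodule disjoint from `B'` is contained in `A'`
  have key : ∀ L : Submodule R E, L ⊓ B' = ⊥ → L.comap h ≤ A' := fun L hL => by
    refine hmax _ (fun a ha => by simp [hA a ha]) ?_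
    rw [eq_bot_iff, ← hL]
    rintro x ⟨hx, hxB⟩
    refine ⟨?_, hxB⟩
    have hx : h x ∈ L := hx
    rwa [hB x hxB] at hx
  have hrange : LinearMap.range h ≤ B' := by
    refine hB'.2 (eq_bot_iff.2 ?_) fun b hb => ⟨b, hB b hb⟩
    rintro _ ⟨⟨x, rfl⟩, hx⟩
    exact hA x (key A' hd hx)
  have hker : ∀ x, h x = 0 → x ∈ A' := fun x hx => key ⊥ (by simp) (by simp [hx])
  refine ⟨A', B', hAA', hBB', disjoint_iff.2 hd, codisjoint_iff.2 (eq_top_iff.2 fun x _ => ?_)⟩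
  have hx : h x ∈ B' := hrange ⟨x, rfl⟩
  exact Submodule.mem_sup.2 ⟨x - h x, hker _ (by rw [map_sub, hB _ hx, sub_self]), h x, hx,
    sub_add_cancel _ _⟩

theorem Module.Injective.of_retract {K : Type w} [AddCommGroup K] [Module R K]
    (hE : Module.Injective R E) (ι : K →ₗ[R] E) (p : E →ₗ[R] K) (hp : ∀ k, p (ι k) = k) :
    Module.Injective R K where
  out X Y _ _ _ _ i hi k := by
    obtain ⟨h, hh⟩ := hE.out i hi (ι ∘ₗ k)
    exact ⟨p ∘ₗ h, fun x => by simp [hh, hp]⟩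

/-- A submodule `N` of an injective module has an essential extension that is a direct
summand. -/
theorem Module.Injective.exists_isCompl_essential (hE : Module.Injective R E)
    (N : Submodule R E) : ∃ N' K, N ≤ N' ∧ IsCompl N' K ∧ N ⊓ K = ⊥ ∧
      ∀ x ∈ N', x ≠ 0 → ∃ r : R, r • x ≠ 0 ∧ r • x ∈ N := by
  obtain ⟨K, -, hK⟩ := Submodule.exists_maximal_disjoint (bot_inf_eq N)
  obtain ⟨N', K', hN, hKK', hc⟩ := hE.exists_isCompl_of_disjoint
    (show N ⊓ K = ⊥ by rw [inf_comm]; exact hK.prop)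
  have hdK' : K' ⊓ N = ⊥ :=
    eq_bot_iff.2 ((inf_le_inf_left K' hN).trans (by rw [inf_comm]; exact hc.inf_eq_bot.le))
  refine ⟨N', K', hN, hc, by rw [inf_comm]; exact hdK', fun x hx hx0 => ?_⟩
  by_contra! hcon
  -- If no nonzero multiple of `x` lay in `N`, then `K + Rx` would still be disjoint from `N`,
  -- against maximality of `K`.
  have hle : K ⊔ R ∙ x ≤ K := by
    refine hK.2 (eq_bot_iff.2 ?_) le_sup_left
    rintro y ⟨hy, hyN⟩
    obtain ⟨k, hk, z, hz, rfl⟩ := Submodule.mem_sup.1 hy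
    obtain ⟨r, rfl⟩ := Submodule.mem_span_singleton.1 hz
    have hkN' : k ∈ N' ⊓ K' := by
      refine ⟨?_, hKK' hk⟩
      simpa using N'.sub_mem (hN hyN) (N'.smul_mem r hx)
    rw [hc.inf_eq_bot, Submodule.mem_bot] at hkN'
    subst hkN'
    rw [zero_add] at hyN ⊢
    by_contra h0
    exact hcon r h0 hyN
  have hxK : x ∈ N' ⊓ K' :=
    ⟨hx, hKK' (hle (Submodule.mem_sup_right (Submodule.mem_span_singleton_self x)))⟩
  rw [hc.inf_eq_bot] at hxK
  exact hx0 hxK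

end Complements

/-! ### Clean pairs and their existence -/

section CleanPairs

variable {R : Type u} [Ring R] {E : Type w} [AddCommGroup E] [Module R E]

/-- A pair of submodules `A`, `B` on which `f` is clean up to essential submodules: the sums
`A + B` and `f A + (1 - f) B` are direct, `f` is injective on `A`, `1 - f` is injective on `B`,
and each of the two sums meets every nonzero submodule of the other one. -/
structure IsCleanPair (f : Module.End R E) (A B : Submodule R E) : Prop where
  eq_zero_of_add : ∀ a ∈ A, ∀ b ∈ B, a + b = 0 → a = 0 ∧ b = 0
  eq_zero_of_map : ∀ a ∈ A, ∀ b ∈ B, f a + (b - f b) = 0 → a = 0 ∧ b = 0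
  essential_add : ∀ x ∈ A ⊔ B, x ≠ 0 → ∃ r : R, r • x ≠ 0 ∧ r • x ∈ A.map f ⊔ B.map (1 - f)
  essential_map : ∀ x ∈ A.map f ⊔ B.map (1 - f), x ≠ 0 → ∃ r : R, r • x ≠ 0 ∧ r • x ∈ A ⊔ B

theorem isCleanPair_bot (f : Module.End R E) : IsCleanPair f ⊥ ⊥ := by
  constructor <;> simp

/-- An embedding that intertwines a clean endomorphism with `f` yields a clean pair. -/
theorem IsCleanPair.of_clean {F : Type*} [AddCommGroup F] [Module R F] {f : Module.End R E}
    {s e x : Module.End R F} (he : IsIdempotentElem e) (hx : IsUnit x) (hs : s = e + x)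
    (Ψ : F →ₗ[R] E) (hΨ : Function.Injective Ψ) (hf : ∀ v, f (Ψ v) = Ψ (s v)) :
    IsCleanPair f ((LinearMap.ker e).map Ψ) ((LinearMap.range e).map Ψ) := by
  subst hs
  have hee : ∀ v, e (e v) = e v := fun v => LinearMap.congr_fun he v
  have hxb := (Module.End.isUnit_iff x).1 hx
  have hsplit : ∀ v, Ψ v ∈ (LinearMap.ker e).map Ψ ⊔ (LinearMap.range e).map Ψ := fun v =>
    Submodule.mem_sup.2 ⟨_, ⟨v - e v, by simp [hee], rfl⟩, _, ⟨e v, ⟨v, rfl⟩, rfl⟩, by simp⟩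
  constructor
  · rintro _ ⟨v, hv, rfl⟩ _ ⟨_, ⟨w, rfl⟩, rfl⟩ h
    have hv : e v = 0 := hv
    have h1 : v + e w = 0 := hΨ (by simpa using h)
    have h2 : e w = 0 := by simpa [hv, hee] using congrArg e h1
    have h3 : v = 0 := by simpa [h2] using h1
    simp [h2, h3]
  · rintro _ ⟨v, hv, rfl⟩ _ ⟨_, ⟨w, rfl⟩, rfl⟩ h
    have hv : e v = 0 := hv
    -- `s` is `x` on the kernel of `e`, and `1 - s` is `-x` on its range.
    have h0 : x (v - e w) = 0 := hΨ (by
      rw [map_zero, ← h]; simp [hf, hv, hee]; abel)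
    have h1 : v - e w = 0 := hxb.1 (by rw [h0, map_zero])
    have h2 : e w = 0 := by simpa [hv, hee] using congrArg e h1
    have h3 : v = 0 := by simpa [h2] using h1
    simp [h2, h3]
  · intro t ht ht0
    obtain ⟨_, ⟨v, hv, rfl⟩, _, ⟨w, hw, rfl⟩, rfl⟩ := Submodule.mem_sup.1 ht
    obtain ⟨y, hy⟩ := hxb.2 (v + w)
    refine ⟨1, by rwa [one_smul], Submodule.mem_sup.2 ⟨_, ⟨_, ⟨y - e y, by simp [hee], rfl⟩, rfl⟩,
      _, ⟨_, ⟨e (-y), ⟨-y, rfl⟩, rfl⟩, rfl⟩, ?_⟩⟩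
    rw [one_smul, ← map_add, ← hy]
    simp [hf, hee]
  · intro t ht ht0
    obtain ⟨_, ⟨_, ⟨v, hv, rfl⟩, rfl⟩, _, ⟨_, ⟨w, hw, rfl⟩, rfl⟩, rfl⟩ := Submodule.mem_sup.1 ht
    refine ⟨1, by rwa [one_smul], ?_⟩
    rw [one_smul, LinearMap.sub_apply, Module.End.one_apply, hf, hf, ← map_sub, ← map_add]
    exact hsplit _

/-- The endomorphism `(x, y, z) ↦ (σ z, x, y)` of `P³` is clean. -/
theorem exists_clean_cyclic_shift {P : Type*} [AddCommGroup P] [Module R P]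
    (σ : Module.End R P) : ∃ s e x : Module.End R (P × P × P), IsIdempotentElem e ∧ IsUnit x ∧
      s = e + x ∧ ∀ v, s v = (σ v.2.2, v.1, v.2.1) := by
  let p₁ := LinearMap.fst R P (P × P)
  let p₂ := LinearMap.fst R P P ∘ₗ LinearMap.snd R P (P × P)
  let p₃ := LinearMap.snd R P P ∘ₗ LinearMap.snd R P (P × P)
  let s : Module.End R (P × P × P) := (σ ∘ₗ p₃).prod (p₁.prod p₂)
  -- With this choice `s - e` is `(x, y, z) ↦ (σ z - x - z, -z, y)`, invertible whatever `σ` is.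
  let e : Module.End R (P × P × P) := (p₁ + p₃).prod ((p₁ + p₃).prod 0)
  refine ⟨s, e, s - e, ?_, ?_, by abel, fun v => rfl⟩
  · refine LinearMap.ext fun v => ?_
    simp [e, p₁, p₃]
  · rw [Module.End.isUnit_iff]
    constructor
    · rw [injective_iff_map_eq_zero]
      rintro ⟨a, b, c⟩ h
      simp [s, e, p₁, p₂, p₃] at h
      obtain ⟨h1, h2, h3⟩ := h
      simp_all
    · rintro ⟨a, b, c⟩
      refine ⟨(σ (-b) + b - a, c, -b), ?_⟩
      simp [s, e, p₁, p₂, p₃]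
      abel

/-- If `g` is injective and `C` is disjoint from its range, then `C` is contained in a submodule
`P` that is stable under `g³` and for which the sum `P + g P + g² P` is direct. -/
theorem exists_shift_invariant {g : Module.End R E} (hg : Function.Injective g)
    {C : Submodule R E} (hC : C ⊓ LinearMap.range g = ⊥) :
    ∃ P : Submodule R E, C ≤ P ∧ (∀ x ∈ P, g (g (g x)) ∈ P) ∧
      ∀ x ∈ P, ∀ y ∈ P, ∀ z ∈ P, x + g y + g (g z) = 0 → x = 0 ∧ y = 0 ∧ z = 0 := by
  -- `Q n` is the sum of `g^(3k) C` for `k < n`, and `P` will be the union. The sum of all `g^k C`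
  -- is direct, and `P`, `g P`, `g² P` use exponents in different classes mod 3.
  let Q : ℕ → Submodule R E := fun n => Nat.rec ⊥ (fun _ L => C ⊔ L.map (g ∘ₗ g ∘ₗ g)) n
  have hQs : ∀ n, Q (n + 1) = C ⊔ (Q n).map (g ∘ₗ g ∘ₗ g) := fun n => rfl
  have hmono : Monotone Q := by
    refine monotone_nat_of_le_succ fun n => ?_
    induction n with
    | zero => exact bot_le
    | succ n ih => rw [hQs, hQs (n + 1)]; exact sup_le_sup_left (Submodule.map_mono ih) _
  have hcancel : ∀ c ∈ C, ∀ t, c + g t = 0 → c = 0 ∧ t = 0 := by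
    intro c hc t h
    have h1 : c ∈ C ⊓ LinearMap.range g :=
      ⟨hc, -t, by rw [map_neg, eq_neg_of_add_eq_zero_left h]⟩
    rw [hC, Submodule.mem_bot] at h1
    subst h1
    exact ⟨rfl, hg (by simpa using h)⟩
  have hind : ∀ n, ∀ x ∈ Q n, ∀ y ∈ Q n, ∀ z ∈ Q n, x + g y + g (g z) = 0 →
      x = 0 ∧ y = 0 ∧ z = 0 := by
    intro n
    induction n with
    | zero => intro x hx y hy z hz _; exact ⟨hx, hy, hz⟩
    | succ n ih =>
      intro x hx' y hy' z hz' h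
      rw [hQs] at hx' hy' hz'
      obtain ⟨a, ha, _, ⟨x, hx, rfl⟩, rfl⟩ := Submodule.mem_sup.1 hx'
      obtain ⟨b, hb, _, ⟨y, hy, rfl⟩, rfl⟩ := Submodule.mem_sup.1 hy'
      obtain ⟨c, hc, _, ⟨z, hz, rfl⟩, rfl⟩ := Submodule.mem_sup.1 hz'
      simp only [LinearMap.comp_apply] at h ⊢
      obtain ⟨ha0, h⟩ := hcancel a ha (g (g x) + (b + g (g (g y))) + g (c + g (g (g z))))
        (by rw [← h]; simp only [map_add]; abel)
      obtain ⟨hb0, h⟩ := hcancel b hb (g x + g (g y) + (c + g (g (g z))))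
        (by rw [← h]; simp only [map_add]; abel)
      obtain ⟨hc0, h⟩ := hcancel c hc (x + g y + g (g z))
        (by rw [← h]; simp only [map_add]; abel)
      obtain ⟨hx0, hy0, hz0⟩ := ih x hx y hy z hz h
      simp [ha0, hb0, hc0, hx0, hy0, hz0]
  have hmem : ∀ x, x ∈ ⨆ n, Q n ↔ ∃ n, x ∈ Q n := fun x =>
    Submodule.mem_iSup_of_directed _ hmono.directed_le
  refine ⟨⨆ n, Q n, le_iSup_of_le 1 (le_sup_left.trans (hQs 0).ge), fun x hx => ?_, ?_⟩
  · obtain ⟨n, hn⟩ := (hmem x).1 hx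
    exact (hmem _).2 ⟨n + 1, by rw [hQs]; exact Submodule.mem_sup_right ⟨x, hn, rfl⟩⟩
  · intro x hx y hy z hz
    obtain ⟨l, hl⟩ := (hmem x).1 hx
    obtain ⟨m, hm⟩ := (hmem y).1 hy
    obtain ⟨n, hn⟩ := (hmem z).1 hz
    exact hind (l + m + n) x (hmono (by omega) hl) y (hmono (by omega) hm) z
      (hmono (by omega) hn)

/-- Every endomorphism of a nonzero injective module has a nonzero clean pair. -/
theorem Module.Injective.exists_isCleanPair [Nontrivial E] (hE : Module.Injective R E)
    (g : Module.End R E) : ∃ A B, IsCleanPair g A B ∧ A ⊔ B ≠ ⊥ := by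
  have hne : ∀ {F : Type w} [AddCommGroup F] [Module R F] [Nontrivial F]
      {s e x : Module.End R F}, IsIdempotentElem e → IsUnit x → s = e + x →
      ∀ Ψ : F →ₗ[R] E, Function.Injective Ψ → (∀ v, g (Ψ v) = Ψ (s v)) →
      ∃ A B, IsCleanPair g A B ∧ A ⊔ B ≠ ⊥ := by
    intro F _ _ _ s e x he hx hs Ψ hΨ hf
    refine ⟨_, _, IsCleanPair.of_clean he hx hs Ψ hΨ hf, fun hbot => ?_⟩
    have hee : ∀ v, e (e v) = e v := fun v => LinearMap.congr_fun he v
    obtain ⟨v, hv⟩ := exists_ne (0 : F)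
    have hmem : Ψ v ∈ (LinearMap.ker e).map Ψ ⊔ (LinearMap.range e).map Ψ :=
      Submodule.mem_sup.2 ⟨_, ⟨v - e v, by simp [hee], rfl⟩, _, ⟨e v, ⟨v, rfl⟩, rfl⟩, by simp⟩
    rw [hbot, Submodule.mem_bot] at hmem
    exact hv (hΨ (by rw [hmem, map_zero]))
  by_cases hker : LinearMap.ker g = ⊥
  · have hg := LinearMap.ker_eq_bot.1 hker
    by_cases hsurj : Function.Surjective g
    · exact hne (s := g) (e := 0) (x := g) IsIdempotentElem.zero
        ((Module.End.isUnit_iff g).2 ⟨hg, hsurj⟩) (zero_add g).symm LinearMap.id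
        Function.injective_id fun v => rfl
    · obtain ⟨ρ, hρ⟩ := hE.out g hg LinearMap.id
      have hC : LinearMap.ker ρ ⊓ LinearMap.range g = ⊥ := by
        rw [eq_bot_iff]
        rintro _ ⟨hx, y, rfl⟩
        have hx : ρ (g y) = 0 := hx
        rw [hρ] at hx
        have hy : y = 0 := hx
        simp [hy]
      obtain ⟨P, hCP, hP, hinj⟩ := exists_shift_invariant hg hC
      have hPnt : Nontrivial P := by
        rw [Submodule.nontrivial_iff_ne_bot]
        rintro rfl
        have hρi : Function.Injective ρ := LinearMap.ker_eq_bot.1 (le_bot_iff.1 hCP)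
        exact hsurj fun y => ⟨ρ y, hρi (hρ (ρ y))⟩
      obtain ⟨s, e, x, he, hx, hs, hsv⟩ := exists_clean_cyclic_shift
        ((g ∘ₗ g ∘ₗ g).restrict (p := P) (q := P) hP)
      refine hne he hx hs (P.subtype.coprod ((g ∘ₗ P.subtype).coprod (g ∘ₗ g ∘ₗ P.subtype)))
        ?_ ?_
      · rw [injective_iff_map_eq_zero]
        rintro ⟨a, b, c⟩ h
        obtain ⟨h1, h2, h3⟩ := hinj a a.2 b b.2 c c.2 (by rw [← h]; simp [add_assoc])
        simp_all
      · intro v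
        rw [hsv]
        simp
        abel
  · have : Nontrivial (LinearMap.ker g) := (Submodule.nontrivial_iff_ne_bot).2 hker
    exact hne (F := LinearMap.ker g) (s := 0) (e := 1) (x := -1) IsIdempotentElem.one
      ((Module.End.isUnit_iff _).2 neg_involutive.bijective) (by simp) (LinearMap.ker g).subtype Subtype.val_injective fun v => by simp

/-! ### Enlarging a clean pair -/

/-- If `z` lies in a submodule in which `N` is essential and `y ≠ 0` has annihilator contained
in that of `z`, then some multiple of `y` is nonzero while that of `z` lies in `N`. -/
theorem exists_smul_ne_zero_mem {F : Type*} [AddCommGroup F] [Module R F] {N : Submodule R E}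
    {y : F} {z : E} (hy : y ≠ 0) (hyz : ∀ r : R, r • y = 0 → r • z = 0)
    (hz : z ≠ 0 → ∃ r : R, r • z ≠ 0 ∧ r • z ∈ N) : ∃ r : R, r • y ≠ 0 ∧ r • z ∈ N := by
  by_cases h : z = 0
  · exact ⟨1, by rwa [one_smul], by simp [h]⟩
  · obtain ⟨r, hr, hrN⟩ := hz h
    exact ⟨r, fun h => hr (hyz r h), hrN⟩

theorem mem_map_sup_map_one_sub {f : Module.End R E} {A B : Submodule R E} {x : E} :
    x ∈ A.map f ⊔ B.map (1 - f) ↔ ∃ a ∈ A, ∃ b ∈ B, f a + (b - f b) = x := by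
  simp [Submodule.mem_sup]

/-- Let `N` be the sum of a clean pair of `f`, essential in the kernel of a retraction `p` of `E`
onto `K`. A clean pair of the endomorphism of `K` induced by `f` then extends the given one. -/
theorem IsCleanPair.extend {K : Type*} [AddCommGroup K] [Module R K] {f : Module.End R E}
    {A B : Submodule R E} (h : IsCleanPair f A B) (ι : K →ₗ[R] E) (p : E →ₗ[R] K)
    (hp : ∀ k, p (ι k) = k) (hpN : ∀ x ∈ A ⊔ B, p x = 0)
    (hess : ∀ x, p x = 0 → x ≠ 0 → ∃ r : R, r • x ≠ 0 ∧ r • x ∈ A ⊔ B)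
    {A₁ B₁ : Submodule R K} (h₁ : IsCleanPair (p ∘ₗ f ∘ₗ ι) A₁ B₁) :
    IsCleanPair f (A ⊔ A₁.map ι) (B ⊔ B₁.map ι) := by
  have hpA : ∀ x ∈ A, p x = 0 := fun x hx => hpN x (Submodule.mem_sup_left hx)
  have hpB : ∀ x ∈ B, p x = 0 := fun x hx => hpN x (Submodule.mem_sup_right hx)
  have hle : A.map f ⊔ B.map (1 - f) ≤ (A ⊔ A₁.map ι).map f ⊔ (B ⊔ B₁.map ι).map (1 - f) :=
    sup_le_sup (Submodule.map_mono le_sup_left) (Submodule.map_mono le_sup_left)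
  have hmap : ∀ a ∈ A, ∀ b ∈ B, ∀ k ∈ A₁, ∀ l ∈ B₁,
      (f a + (b - f b)) + (f (ι k) + (ι l - f (ι l))) = 0 → a = 0 ∧ b = 0 ∧ k = 0 ∧ l = 0 := by
    intro a ha b hb k hk l hl hsum
    by_contra hne
    -- Taking the whole quadruple as `y` keeps it nonzero while its first summand moves into the
    -- kernel of `p`; applying `p` then leaves a relation in `K` alone.
    obtain ⟨r, hr, hrN⟩ := exists_smul_ne_zero_mem (R := R) (N := A ⊔ B) (y := (a, b, k, l))
      (z := f a + (b - f b)) (by simpa using hne)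
      (fun r hr => by
        simp only [Prod.smul_mk, Prod.mk_eq_zero] at hr
        simp [smul_add, smul_sub, ← map_smul, hr])
      (fun hz => h.essential_map _ (mem_map_sup_map_one_sub.2 ⟨a, ha, b, hb, rfl⟩) hz)
    have hsum' := congrArg (fun t => p (r • t)) hsum
    simp only [smul_add r (f a + (b - f b)), map_add p (r • (f a + (b - f b))), hpN _ hrN] at hsum'
    obtain ⟨hk0, hl0⟩ := h₁.eq_zero_of_map _ (A₁.smul_mem r hk) _ (B₁.smul_mem r hl) (by
      simpa [smul_add, smul_sub, hp] using hsum')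
    have hsum'' := congrArg (fun t => r • t) hsum
    obtain ⟨ha0, hb0⟩ := h.eq_zero_of_map _ (A.smul_mem r ha) _ (B.smul_mem r hb) (by
      simpa only [smul_add, smul_sub, ← map_smul, hk0, hl0, map_zero, sub_zero, add_zero,
        smul_zero] using hsum'')
    exact hr (by simp [ha0, hb0, hk0, hl0])
  refine ⟨?_, ?_, ?_, ?_⟩
  · intro a' ha' b' hb' hsum
    obtain ⟨a, ha, _, ⟨k, hk, rfl⟩, rfl⟩ := Submodule.mem_sup.1 ha'
    obtain ⟨b, hb, _, ⟨l, hl, rfl⟩, rfl⟩ := Submodule.mem_sup.1 hb'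
    have hsum' := congrArg p hsum
    obtain ⟨hk0, hl0⟩ := h₁.eq_zero_of_add k hk l hl (by
      simpa [hpA a ha, hpB b hb, hp] using hsum')
    obtain ⟨ha0, hb0⟩ := h.eq_zero_of_add a ha b hb (by simpa [hk0, hl0] using hsum)
    simp [ha0, hb0, hk0, hl0]
  · intro a' ha' b' hb' hsum
    obtain ⟨a, ha, _, ⟨k, hk, rfl⟩, rfl⟩ := Submodule.mem_sup.1 ha'
    obtain ⟨b, hb, _, ⟨l, hl, rfl⟩, rfl⟩ := Submodule.mem_sup.1 hb'
    obtain ⟨ha0, hb0, hk0, hl0⟩ := hmap a ha b hb k hk l hl (by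
      rw [← hsum]; simp only [map_add]; abel)
    simp [ha0, hb0, hk0, hl0]
  · intro x hx hx0
    have hpx : p x ∈ A₁ ⊔ B₁ := by
      obtain ⟨a', ha', b', hb', rfl⟩ := Submodule.mem_sup.1 hx
      obtain ⟨a, ha, _, ⟨k, hk, rfl⟩, rfl⟩ := Submodule.mem_sup.1 ha'
      obtain ⟨b, hb, _, ⟨l, hl, rfl⟩, rfl⟩ := Submodule.mem_sup.1 hb'
      simpa [hpA a ha, hpB b hb, hp] using Submodule.add_mem_sup hk hl
    -- elements of the kernel of `p` have multiples in `f A + (1 - f) B`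
    have hker : ∀ z, p z = 0 → z ≠ 0 → ∃ r : R, r • z ≠ 0 ∧
        r • z ∈ A.map f ⊔ B.map (1 - f) := fun z hz hz0 => by
      obtain ⟨r, hr, hrN⟩ := hess z hz hz0
      obtain ⟨t, ht, htN⟩ := h.essential_add _ hrN hr
      exact ⟨t * r, by rwa [mul_smul], by rwa [mul_smul]⟩
    by_cases hpx0 : p x = 0
    · obtain ⟨r, hr, hrN⟩ := hker x hpx0 hx0
      exact ⟨r, hr, hle hrN⟩
    · obtain ⟨r, hr, hrN⟩ := h₁.essential_add _ hpx hpx0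
      obtain ⟨k, hk, l, hl, hkl⟩ := mem_map_sup_map_one_sub.1 hrN
      have hη : ∀ t : R, f (ι (t • k)) + (ι (t • l) - f (ι (t • l))) =
          t • (f (ι k) + (ι l - f (ι l))) := fun t => by simp [smul_add, smul_sub]
      have hpη : p (f (ι k) + (ι l - f (ι l))) = r • p x := by rw [← hkl]; simp [hp]
      -- The second summand of `z` has the same image under `p` as `r • x`, so `z` lies in the
      -- kernel of `p`, where `hker` applies.
      obtain ⟨t, ht, htN⟩ := exists_smul_ne_zero_mem (R := R) (y := r • x)
        (z := r • x - (f (ι k) + (ι l - f (ι l))))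
        (fun h0 => hr (by rw [← map_smul, h0, map_zero]))
        (fun t ht => by
          obtain ⟨hk0, hl0⟩ := h₁.eq_zero_of_map _ (A₁.smul_mem t hk) _ (B₁.smul_mem t hl) (by
            have h2 : t • (r • p x) = 0 := by rw [← map_smul, ← map_smul, ht, map_zero]
            rw [← h2, ← hkl]
            simp [smul_add, smul_sub])
          rw [smul_sub, ht, ← hη, hk0, hl0]
          simp)
        (hker _ (by rw [map_sub, hpη, map_smul, sub_self]))
      refine ⟨t * r, by rwa [mul_smul], ?_⟩
      rw [mul_smul, ← sub_add_cancel (t • r • x) (t • (f (ι k) + (ι l - f (ι l)))), ← smul_sub]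
      refine Submodule.add_mem _ (hle htN) (mem_map_sup_map_one_sub.2 ⟨ι (t • k), ?_, ι (t • l),
        ?_, hη t⟩)
      · exact Submodule.mem_sup_right ⟨_, A₁.smul_mem t hk, rfl⟩
      · exact Submodule.mem_sup_right ⟨_, B₁.smul_mem t hl, rfl⟩
  · intro x hx hx0
    obtain ⟨a', ha', b', hb', rfl⟩ := mem_map_sup_map_one_sub.1 hx
    obtain ⟨a, ha, _, ⟨k, hk, rfl⟩, rfl⟩ := Submodule.mem_sup.1 ha'
    obtain ⟨b, hb, _, ⟨l, hl, rfl⟩, rfl⟩ := Submodule.mem_sup.1 hb'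
    set z := f a + (b - f b) with hz
    set d := f (ι k) + (ι l - f (ι l)) with hd
    have hxz : f (a + ι k) + (b + ι l - f (b + ι l)) = z + d := by
      simp only [hz, hd, map_add]; abel
    rw [hxz] at hx0 ⊢
    have hann : ∀ r : R, r • (z + d) = 0 → r • z = 0 ∧ r • d = 0 := fun r hr => by
      obtain ⟨ha0, hb0, hk0, hl0⟩ := hmap _ (A.smul_mem r ha) _ (B.smul_mem r hb) _
        (A₁.smul_mem r hk) _ (B₁.smul_mem r hl) (by
          rw [← hr, hz, hd]; simp [smul_add, smul_sub])
      have hrz : r • z = 0 := by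
        rw [hz, smul_add, smul_sub, ← map_smul, ← map_smul, ha0, hb0]; simp
      rw [smul_add, hrz, zero_add] at hr
      exact ⟨hrz, hr⟩
    have hpd : p d ∈ A₁.map (p ∘ₗ f ∘ₗ ι) ⊔ B₁.map (1 - p ∘ₗ f ∘ₗ ι) :=
      mem_map_sup_map_one_sub.2 ⟨k, hk, l, hl, by simp [hd, hp]⟩
    -- Three scalars in turn move `z`, `d - ι (p d)` and `p d` into `A + B`, `A + B` and `A₁ + B₁`;
    -- by `hann` the multiple of `z + d` stays nonzero.
    obtain ⟨r, hr, hrz⟩ := exists_smul_ne_zero_mem (R := R) (y := z + d) (z := z) hx0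
      (fun r hr => (hann r hr).1)
      (h.essential_map _ (mem_map_sup_map_one_sub.2 ⟨a, ha, b, hb, rfl⟩))
    obtain ⟨s, hs, hsd⟩ := exists_smul_ne_zero_mem (R := R) (y := r • (z + d))
      (z := r • (d - ι (p d))) hr
      (fun s hs => by
        have h2 := (hann (s * r) (by rwa [mul_smul])).2
        rw [← mul_smul, smul_sub, ← map_smul, ← map_smul, h2]; simp)
      (hess _ (by rw [map_smul, map_sub, hp, sub_self, smul_zero]))
    obtain ⟨t, ht, htd⟩ := exists_smul_ne_zero_mem (R := R) (y := s • r • (z + d))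
      (z := s • r • p d) hs
      (fun t ht => by
        have h2 := (hann (t * s * r) (by rwa [mul_smul, mul_smul])).2
        rw [← mul_smul, ← mul_smul, ← map_smul, h2, map_zero])
      (h₁.essential_map _ (Submodule.smul_mem _ _ (Submodule.smul_mem _ _ hpd)))
    refine ⟨t * s * r, by rwa [mul_smul, mul_smul], ?_⟩
    have hdecomp : (t * s * r) • (z + d) =
        t • s • r • z + t • s • r • (d - ι (p d)) + ι (t • s • r • p d) := by
      simp only [mul_smul, map_smul, ← smul_add]
      congr 3
      abel
    have hNle : A ⊔ B ≤ (A ⊔ A₁.map ι) ⊔ (B ⊔ B₁.map ι) := sup_le_sup le_sup_left le_sup_left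
    rw [hdecomp]
    refine Submodule.add_mem _ (hNle (Submodule.add_mem _
      (Submodule.smul_mem _ _ (Submodule.smul_mem _ _ hrz)) (Submodule.smul_mem _ _ hsd))) ?_
    have h2 := Submodule.mem_map_of_mem (f := ι) htd
    rw [Submodule.map_sup] at h2
    exact (sup_le_sup le_sup_right le_sup_right :
      A₁.map ι ⊔ B₁.map ι ≤ (A ⊔ A₁.map ι) ⊔ (B ⊔ B₁.map ι)) h2

/-! ### Maximal clean pairs and cleanness -/

/-- Every endomorphism of a module has a maximal clean pair. -/
theorem exists_maximal_isCleanPair (f : Module.End R E) :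
    ∃ A B, IsCleanPair f A B ∧
      ∀ A' B', IsCleanPair f A' B' → A ≤ A' → B ≤ B' → A' ≤ A ∧ B' ≤ B := by
  suffices hub : ∀ c ⊆ {q : Submodule R E × Submodule R E | IsCleanPair f q.1 q.2},
      IsChain (· ≤ ·) c → ∀ q₀ ∈ c, ∃ ub ∈ {q : Submodule R E × Submodule R E |
        IsCleanPair f q.1 q.2}, ∀ q ∈ c, q ≤ ub by
    obtain ⟨⟨A, B⟩, -, hmax⟩ := zorn_le_nonempty₀ _ hub (⊥, ⊥) (isCleanPair_bot f)
    exact ⟨A, B, hmax.1, fun A' B' h hA hB => hmax.2 (y := (A', B')) h ⟨hA, hB⟩⟩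
  intro c hc hchain q₀ hq₀
  let A := sSup (Prod.fst '' c)
  let B := sSup (Prod.snd '' c)
  have hleA : ∀ q ∈ c, q.1 ≤ A := fun q hq => le_sSup ⟨q, hq, rfl⟩
  have hleB : ∀ q ∈ c, q.2 ≤ B := fun q hq => le_sSup ⟨q, hq, rfl⟩
  -- Each condition on a clean pair involves one `a` and one `b` at a time, so it passes to unions
  -- of chains.
  have hmem : ∀ a ∈ A, ∀ b ∈ B, ∃ q ∈ c, a ∈ q.1 ∧ b ∈ q.2 := by
    intro a ha b hb
    obtain ⟨_, ⟨q, hq, rfl⟩, haq⟩ := (Submodule.mem_sSup_of_directed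
      (Set.Nonempty.image _ ⟨q₀, hq₀⟩)
      (directedOn_image.2 (hchain.directedOn.mono' fun _ _ _ _ h => h.1))).1 ha
    obtain ⟨_, ⟨q', hq', rfl⟩, hbq⟩ := (Submodule.mem_sSup_of_directed
      (Set.Nonempty.image _ ⟨q₀, hq₀⟩)
      (directedOn_image.2 (hchain.directedOn.mono' fun _ _ _ _ h => h.2))).1 hb
    rcases hchain.total hq hq' with hle | hle
    · exact ⟨q', hq', hle.1 haq, hbq⟩
    · exact ⟨q, hq, haq, hle.2 hbq⟩
  refine ⟨(A, B), ?_, fun q hq => ⟨hleA q hq, hleB q hq⟩⟩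
  refine ⟨fun a ha b hb => ?_, fun a ha b hb => ?_, fun x hx hx0 => ?_, fun x hx hx0 => ?_⟩
  · obtain ⟨q, hq, haq, hbq⟩ := hmem a ha b hb
    exact (hc hq).eq_zero_of_add a haq b hbq
  · obtain ⟨q, hq, haq, hbq⟩ := hmem a ha b hb
    exact (hc hq).eq_zero_of_map a haq b hbq
  · obtain ⟨a, ha, b, hb, rfl⟩ := Submodule.mem_sup.1 hx
    obtain ⟨q, hq, haq, hbq⟩ := hmem a ha b hb
    obtain ⟨r, hr, hrN⟩ := (hc hq).essential_add _ (Submodule.add_mem_sup haq hbq) hx0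
    exact ⟨r, hr, SetLike.le_def.1 (sup_le_sup (Submodule.map_mono (hleA q hq))
      (Submodule.map_mono (hleB q hq))) hrN⟩
  · obtain ⟨a, ha, b, hb, rfl⟩ := mem_map_sup_map_one_sub.1 hx
    obtain ⟨q, hq, haq, hbq⟩ := hmem a ha b hb
    obtain ⟨r, hr, hrN⟩ := (hc hq).essential_map _
      (mem_map_sup_map_one_sub.2 ⟨a, haq, b, hbq, rfl⟩) hx0
    exact ⟨r, hr, SetLike.le_def.1 (sup_le_sup (hleA q hq) (hleB q hq)) hrN⟩

/-- Every endomorphism of an injective module has a clean pair with essential sum. -/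
theorem Module.Injective.exists_isCleanPair_essential (hE : Module.Injective R E)
    (f : Module.End R E) : ∃ A B, IsCleanPair f A B ∧
      ∀ x ≠ 0, ∃ r : R, r • x ≠ 0 ∧ r • x ∈ A ⊔ B := by
  obtain ⟨A, B, h, hmax⟩ := exists_maximal_isCleanPair f
  obtain ⟨N', K, hN, hc, hNK, hess⟩ := hE.exists_isCompl_essential (A ⊔ B)
  refine ⟨A, B, h, ?_⟩
  let p : E →ₗ[R] K := K.projectionOnto N' hc.symm
  have hp : ∀ k : K, p (K.subtype k) = k := fun k =>
    Submodule.projectionOnto_apply_left hc.symm k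
  have hpN : ∀ x, p x = 0 ↔ x ∈ N' := fun x => Submodule.projectionOnto_apply_eq_zero_iff hc.symm
  rcases subsingleton_or_nontrivial K with hK | hK
  · exact fun x => hess x ((hpN x).1 (Subsingleton.elim _ _))
  · exfalso
    obtain ⟨A₁, B₁, h₁, hne⟩ := (hE.of_retract K.subtype p hp).exists_isCleanPair
      (p ∘ₗ f ∘ₗ K.subtype)
    have hext := h.extend K.subtype p hp (fun x hx => (hpN x).2 (hN hx))
      (fun x hx => hess x ((hpN x).1 hx)) h₁
    obtain ⟨hA, hB⟩ := hmax _ _ hext le_sup_left le_sup_left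
    refine hne (eq_bot_iff.2 fun k hk => ?_)
    have hk' := Submodule.mem_map_of_mem (f := K.subtype) hk
    rw [Submodule.map_sup] at hk'
    have hk0 : (k : E) ∈ (A ⊔ B) ⊓ K :=
      ⟨SetLike.le_def.1 (sup_le_sup (le_sup_right.trans hA) (le_sup_right.trans hB)) hk', k.2⟩
    rw [hNK, Submodule.mem_bot] at hk0
    exact (Submodule.mem_bot R).2 (Subtype.ext hk0)

/-- The endomorphism ring of an injective module is clean. -/
theorem Module.Injective.isCleanRing_end (hE : Module.Injective R E) :
    IsCleanRing (Module.End R E) := by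
  intro f
  obtain ⟨A, B, h, hess⟩ := hE.exists_isCleanPair_essential f
  have hd : B ⊓ A = ⊥ := by
    rw [eq_bot_iff]
    rintro x ⟨hB, hA⟩
    exact (h.eq_zero_of_add (-x) (A.neg_mem hA) x hB (neg_add_cancel x)).2
  obtain ⟨B', A', hB, hA, hc⟩ := hE.exists_isCompl_of_disjoint hd
  let e : Module.End R E := B'.subtype ∘ₗ B'.projectionOnto A' hc
  have heB : ∀ x ∈ B', e x = x := fun x hx =>
    congrArg Subtype.val (Submodule.projectionOnto_apply_left hc ⟨x, hx⟩)
  have heA : ∀ x ∈ A', e x = 0 := fun x hx =>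
    congrArg Subtype.val ((Submodule.projectionOnto_apply_eq_zero_iff hc).2 hx)
  have hu : ∀ a ∈ A, ∀ b ∈ B, (f - e) (a + -b) = f a + (b - f b) := fun a ha b hb => by
    rw [map_add, map_neg, LinearMap.sub_apply, LinearMap.sub_apply, heA a (hA ha), heB b (hB hb)]
    abel
  have hinj : Function.Injective (f - e) := by
    rw [injective_iff_map_eq_zero]
    intro x hx
    by_contra hx0
    obtain ⟨r, hr, hrN⟩ := hess x hx0
    obtain ⟨a, ha, b, hb, hab⟩ := Submodule.mem_sup.1 hrN
    have h0 : (f - e) (a + - -b) = 0 := by rw [neg_neg, hab, map_smul, hx, smul_zero]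
    rw [hu a ha (-b) (B.neg_mem hb)] at h0
    obtain ⟨ha0, hb0⟩ := h.eq_zero_of_map a ha (-b) (B.neg_mem hb) h0
    exact hr (by rw [← hab, ha0, neg_eq_zero.1 hb0, add_zero])
  -- The kernel of the retraction `ρ` misses `f A + (1 - f) B`, which is essential; so `ρ` is
  -- injective and `f - e` is onto.
  obtain ⟨ρ, hρ⟩ := hE.out (f - e) hinj LinearMap.id
  have hρinj : Function.Injective ρ := by
    rw [injective_iff_map_eq_zero]
    intro x hx
    by_contra hx0
    obtain ⟨r, hr, hrN⟩ := hess x hx0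
    obtain ⟨t, ht, htN⟩ := h.essential_add _ hrN hr
    obtain ⟨a, ha, b, hb, hab⟩ := mem_map_sup_map_one_sub.1 htN
    have h0 : a + -b = 0 := by
      have h1 := hρ (a + -b)
      rw [hu a ha b hb, hab, map_smul, map_smul, hx, smul_zero, smul_zero] at h1
      exact h1.symm
    refine ht ?_
    rw [← hab, ← hu a ha b hb, h0, map_zero]
  refine ⟨e, f - e, LinearMap.ext fun x => heB _ (Subtype.property _), ?_, by abel⟩
  exact (Module.End.isUnit_iff _).2 ⟨hinj, fun y => ⟨ρ y, hρinj (hρ (ρ y))⟩⟩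

end CleanPairs

theorem mainTheorem4 {R : Type u} [Ring R] {M : Type v} [AddCommGroup M] [Module R M]
    (hM : IsAutomorphismInvariant R M) : IsCleanRing (Module.End R M) := by
  obtain ⟨E, _, _, i, hi, hinv⟩ := hM
  intro a
  let j := LinearEquiv.ofInjective i hi.injective_map
  obtain ⟨f, hf⟩ := hi.injective_module.out (LinearMap.range i).subtype Subtype.val_injective
    (i ∘ₗ a ∘ₗ j.symm.toLinearMap)
  have hfi : ∀ m, f (i m) = i (a m) := fun m => by simpa [j] using hf (j m)
  obtain ⟨e, x, he, hx, hfex⟩ := hi.injective_module.isCleanRing_end f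
  -- endomorphisms of `E` that preserve `M` restrict to `M`
  have hres : ∀ h : Module.End R E, (∀ m, h (i m) ∈ LinearMap.range i) →
      ∃ b : Module.End R M, ∀ m, i (b m) = h (i m) := fun h hh =>
    ⟨j.symm.toLinearMap ∘ₗ (h ∘ₗ i).codRestrict _ hh, fun m =>
      congrArg Subtype.val (j.apply_symm_apply ⟨h (i m), hh m⟩)⟩
  obtain ⟨y, rfl⟩ := hx
  let g : E ≃ₗ[R] E := LinearMap.GeneralLinearGroup.toLinearEquiv y
  obtain ⟨b, hb⟩ := hres y fun m => hinv g ⟨i m, ⟨m, rfl⟩, rfl⟩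
  -- Invariance under the inverse automorphism makes the restriction `b` a unit, not merely
  -- injective.
  obtain ⟨b', hb'⟩ := hres (y⁻¹ : (Module.End R E)ˣ) fun m => hinv g.symm ⟨i m, ⟨m, rfl⟩, rfl⟩
  have hei : ∀ m, i ((a - b) m) = e (i m) := fun m => by
    rw [LinearMap.sub_apply, map_sub, hb, ← hfi, hfex, LinearMap.add_apply, add_sub_cancel_right]
  refine ⟨a - b, b, ?_, ?_, by abel⟩
  · refine LinearMap.ext fun m => hi.injective_map ?_
    rw [Module.End.mul_apply, hei, hei]
    exact LinearMap.congr_fun he (i m)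
  · refine ⟨⟨b, b', ?_, ?_⟩, rfl⟩ <;> refine LinearMap.ext fun m => hi.injective_map ?_
    · rw [Module.End.mul_apply, hb, hb', ← Module.End.mul_apply, Units.mul_inv]; rfl
    · rw [Module.End.mul_apply, hb', hb, ← Module.End.mul_apply, Units.inv_mul]; rfl
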